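/- \textbf{Lemma (Property (P5): gap growth during one phase of 3-majority).} Consider $n$ nodes, each holding one of $k$ opinions. In each synchronous round of the 3-majority dynamics every node independently pulls two nodes, chosen independently and uniformly at random among all $n$ nodes (with replacement), and adopts the majority opinion among its own opinion and the two pulled opinions, ties being broken towards its own opinion. That is, it adopts the opinion of the two pulled nodes if these two agree, and otherwise keeps its own. For a configuration let $p_i$ be the fraction of nodes holding opinion $i$, and let $p_{\max}=\max_i p_i$. Opinion $i$ is \emph{super-weak} if $p_i\le \frac1{10k}$ and \emph{strong} if $p_i\ge p_{\max}/5$. For opinions $i,j$ with $p_j>0$ let $g_{ij}=\frac{p_i-p_j}{p_j}$. There is a universal constant $\delta_0>0$ such that for every $\delta\in(0,\delta_0]$ and every $c\ge 2$ there is a constant $C_5>0$, depending only on $\delta$ and $c$, such that for every $K>0$ there is $n_0\geq 2$, depending only on $\delta,c,C_5,K$, for which the following holds. Let $n\ge n_0$, let $k\le K\sqrt{n/\log n}$, and let $\kappa\ge 2$ be an integer. Start a phase, consisting of $T=\lceil\delta\kappa\rceil$ rounds, from any configuration in which at most $\kappa$ opinions are not super-weak and $p_{\max}\le \frac{1.5}{\kappa}$.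 Let $i,j$ be two strong opinions of this configuration with $p_i\ge p_j$ and $$g_{ij}\ \ge\ \frac{C_5\sqrt{\log n}}{\sqrt{n/\kappa}} .$$ Then with probability at least $1-n^{-c}$ the following holds: if $p_{\max}\le\frac{1.5}{\kappa}$ at the beginning of each of the $T$ rounds of the phase, then the gap $g^{new}_{ij}$ at the end of the phase is defined (opinion $j$ still has support) and satisfies $$g^{new}_{ij}\ \ge\ \Bigl(1+\frac{\delta}{100}\Bigr)\,g_{ij}.$$ -/

import Mathlib

namespace ThreeMajority

/-- An assignment of one of `k` opinions to each of `n` nodes. -/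
abbrev Config (n k : ℕ) := Fin n → Fin k

/-- The random choices of one round: every node pulls an ordered pair of nodes. -/
abbrev Pulls (n : ℕ) := Fin n → Fin n × Fin n

/-- One round of the 3-majority dynamics: each node takes the majority of its own opinion and the
opinions of the two pulled nodes, ties being broken towards its own opinion. Thus a node adopts the
common opinion of the two pulled nodes if these agree, and keeps its own opinion otherwise. -/
def step {n k : ℕ} (x : Config n k) (s : Pulls n) : Config n k :=
  fun v => if x (s v).1 = x (s v).2 then x (s v).1 else x v

/-- The configuration after `t` rounds, started from `x`, when `ω` lists the random choices of `T`
consecutive rounds (only `t ≤ T` is meaningful; the configuration is frozen after round `T`). -/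
def traj {n k T : ℕ} (x : Config n k) (ω : Fin T → Pulls n) : ℕ → Config n k
  | 0 => x
  | t + 1 => if h : t < T then step (traj x ω t) (ω ⟨t, h⟩) else traj x ω t

/-- The law of the random choices of `T` rounds: all pulled nodes are independent and uniform among
the `n` nodes, i.e. the uniform distribution on the finite set of all possible choices. -/
noncomputable def pullLaw (n T : ℕ) : MeasureTheory.Measure (Fin T → Pulls n) :=
  ProbabilityTheory.uniformOn Set.univ

/-- The fraction `p_i` of nodes that hold opinion `i`. -/
noncomputable def frac {n k : ℕ} (x : Config n k) (i : Fin k) : ℝ :=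
  ((Finset.univ.filter fun v => x v = i).card : ℝ) / n

/-- `p_max = max_i p_i`. -/
noncomputable def pmax {n k : ℕ} (x : Config n k) : ℝ := ⨆ i, frac x i

/-- Opinion `i` is super-weak: `p_i ≤ 1 / (10 k)`. -/
def SuperWeak {n k : ℕ} (x : Config n k) (i : Fin k) : Prop := frac x i ≤ 1 / (10 * (k : ℝ))

/-- Opinion `i` is strong: `p_i ≥ p_max / 5`. -/
def Strong {n k : ℕ} (x : Config n k) (i : Fin k) : Prop := pmax x / 5 ≤ frac x i

/-- The gap `g_ij = (p_i - p_j) / p_j` (equal to `0` by convention if `p_j = 0`). -/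
noncomputable def gap {n k : ℕ} (x : Config n k) (i j : Fin k) : ℝ :=
  (frac x i - frac x j) / frac x j

end ThreeMajority

namespace ThreeMajority

open Finset

variable {n k : ℕ}

/-! With S = Σ p_m² ≤ p_max ≤ 1.5/κ, the expected next fraction of opinion l is p_l(1 + p_l - S).
Both opinions share the factor 1 - S ≥ q = 1 - 1.5/κ, while the quadratic term favours the larger
one. The gap thus grows by a factor 1 + Ω(1/κ) per round, and by 1 + Ω(δ) over about δκ rounds.

The ratio is replaced by the linear statistic D = p_i - (1+θ)p_j, whose threshold θ rises by 0.04g/κ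
each round (`target`). While D ≥ 0 and p_j is at least 0.0985/κ, `drift_ge` shows that the expected
next D, with the raised θ, is at least qD. Nodes act independently, so exponential moments of linear
statistics are controlled (`sum_exp_step_le`). Hence `potential`, one exponential guarding D plus
one guarding p_j, does not increase in expectation while it is below one (`potential_step`). By
`card_bad_le` its initial value bounds the failure probability, and `potential_start_le` makes this
at most n^(-c). -/

/-- The sum of the squared opinion fractions: the probability that two pulled nodes agree. -/
noncomputable def collision (x : Config n k) : ℝ := ∑ l, frac x l ^ 2

/-- The average of `y` over the opinions held by the nodes. -/
noncomputable def mean (x : Config n k) (y : Fin k → ℝ) : ℝ := ∑ l, frac x l * y l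

theorem frac_nonneg (x : Config n k) (l : Fin k) : 0 ≤ frac x l := by
  unfold frac; positivity

theorem collision_nonneg (x : Config n k) : 0 ≤ collision x :=
  sum_nonneg fun _ _ => sq_nonneg _

theorem frac_le_pmax (x : Config n k) (l : Fin k) : frac x l ≤ pmax x :=
  le_ciSup (f := fun l => frac x l) (Set.finite_range _).bddAbove l

theorem sum_nodes (hn : 0 < n) (x : Config n k) (y : Fin k → ℝ) :
    ∑ v, y (x v) = n * mean x y := by
  have hn' : (n : ℝ) ≠ 0 := by positivity
  rw [mean, mul_sum, ← sum_fiberwise_of_maps_to (s := univ) (t := univ) (g := x) (by simp)]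
  refine sum_congr rfl fun l _ => ?_
  rw [sum_congr rfl (g := fun _ => y l) (by intro v hv; simp at hv; rw [hv]), sum_const,
    nsmul_eq_mul, frac]
  field_simp

theorem sum_frac (hn : 0 < n) (x : Config n k) : ∑ l, frac x l = 1 := by
  have h := sum_nodes hn x fun _ => 1
  have hn' : (n : ℝ) ≠ 0 := by positivity
  simp only [mean, mul_one, sum_const, card_univ, Fintype.card_fin, nsmul_eq_mul] at h
  exact mul_left_cancel₀ hn' (by linarith)

theorem collision_le_pmax (hn : 0 < n) (x : Config n k) : collision x ≤ pmax x := by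
  calc collision x ≤ ∑ l, pmax x * frac x l := by
        refine sum_le_sum fun l _ => ?_
        nlinarith [frac_le_pmax x l, frac_nonneg x l]
    _ = pmax x := by rw [← mul_sum, sum_frac hn, mul_one]

/-! ### Exponential moments after one round -/

theorem sum_pulled_pair (hn : 0 < n) (x : Config n k) (f : Fin k → ℝ) :
    ∑ s : Fin n × Fin n, (if x s.1 = x s.2 then f (x s.1) else 0) =
      (n : ℝ) ^ 2 * ∑ m, frac x m ^ 2 * f m := by
  rw [Fintype.sum_prod_type]
  have h (u : Fin n) : ∑ u', (if x u = x u' then f (x u) else 0) =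
      n * (frac x (x u) * f (x u)) := by
    rw [sum_nodes hn x (fun m => if x u = m then f (x u) else 0)]
    simp [mean]
  simp only [h]
  rw [sum_nodes hn x (fun m => n * (frac x m * f m)), mean, mul_sum, mul_sum]
  exact sum_congr rfl fun _ _ => by ring

/-- Bound on the exponential moment of the change of `y` at one node of opinion `l`. -/
theorem sum_exp_node_le (hn : 0 < n) (x : Config n k) (y : Fin k → ℝ) (z : ℝ) (l : Fin k)
    (hz : ∀ m, |z * (y m - y l)| ≤ 1) :
    ∑ s : Fin n × Fin n, Real.exp (z * y (if x s.1 = x s.2 then x s.1 else l)) ≤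
      (n : ℝ) ^ 2 * Real.exp (z * y l + z * ∑ m, frac x m ^ 2 * (y m - y l) +
        z ^ 2 * ∑ m, frac x m ^ 2 * (y m - y l) ^ 2) := by
  -- Uses e^u ≤ 1 + u + u² for |u| ≤ 1; a node whose two pulls disagree contributes no change.
  have key (s : Fin n × Fin n) :
      Real.exp (z * y (if x s.1 = x s.2 then x s.1 else l)) ≤ Real.exp (z * y l) *
        (1 + (if x s.1 = x s.2 then
          z * (y (x s.1) - y l) + z ^ 2 * (y (x s.1) - y l) ^ 2 else 0)) := by
    split_ifs with h
    · have h1 := (abs_le.1 (Real.abs_exp_sub_one_sub_id_le (hz (x s.1)))).2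
      have h2 : z * y (x s.1) = z * y l + z * (y (x s.1) - y l) := by ring
      rw [h2, Real.exp_add]
      refine mul_le_mul_of_nonneg_left ?_ (Real.exp_pos _).le
      nlinarith
    · simp
  refine (sum_le_sum fun s _ => key s).trans ?_
  rw [← mul_sum, sum_add_distrib,
    sum_pulled_pair hn x fun m => z * (y m - y l) + z ^ 2 * (y m - y l) ^ 2]
  have hc : ∑ _s : Fin n × Fin n, (1 : ℝ) = (n : ℝ) ^ 2 := by simp [pow_two]
  have hs : ∑ m, frac x m ^ 2 * (z * (y m - y l) + z ^ 2 * (y m - y l) ^ 2) =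
      z * ∑ m, frac x m ^ 2 * (y m - y l) + z ^ 2 * ∑ m, frac x m ^ 2 * (y m - y l) ^ 2 := by
    rw [mul_sum, mul_sum, ← sum_add_distrib]
    exact sum_congr rfl fun _ _ => by ring
  rw [hc, hs, add_assoc (z * y l), Real.exp_add (z * y l)]
  have h3 := Real.add_one_le_exp (z * ∑ m, frac x m ^ 2 * (y m - y l) +
    z ^ 2 * ∑ m, frac x m ^ 2 * (y m - y l) ^ 2)
  have h4 : 0 ≤ Real.exp (z * y l) * (n : ℝ) ^ 2 := by positivity
  nlinarith [mul_le_mul_of_nonneg_left h3 h4]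

theorem card_pulls : (Fintype.card (Pulls n) : ℝ) = ((n : ℝ) ^ 2) ^ n := by
  simp [Pulls, pow_two]

/-- The conditional expectation of `mean · y` after one round. -/
noncomputable def nextMean (x : Config n k) (y : Fin k → ℝ) : ℝ :=
  (1 - collision x) * mean x y + ∑ m, frac x m ^ 2 * y m

theorem sum_nodes_drift (hn : 0 < n) (x : Config n k) (y : Fin k → ℝ) :
    ∑ v, (y (x v) + ∑ m, frac x m ^ 2 * (y m - y (x v))) = n * nextMean x y := by
  have h (l : Fin k) : ∑ m, frac x m ^ 2 * (y m - y l) =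
      ∑ m, frac x m ^ 2 * y m - collision x * y l := by
    rw [collision, sum_mul, ← sum_sub_distrib]
    exact sum_congr rfl fun _ _ => by ring
  simp only [h]
  rw [sum_add_distrib, sum_sub_distrib, ← mul_sum, sum_nodes hn]
  simp [nextMean]
  ring

/-- Since (a-b)² ≤ 2a² + 2b², and a change has probability S ≤ p_max, each of the two halves
contributes at most 2 n p_max times the mean of y². -/
theorem sum_nodes_variance_le (hn : 0 < n) (x : Config n k) (y : Fin k → ℝ) :
    ∑ v, ∑ m, frac x m ^ 2 * (y m - y (x v)) ^ 2 ≤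
      4 * n * pmax x * mean x fun l => y l ^ 2 := by
  have h (l : Fin k) : ∑ m, frac x m ^ 2 * (y m - y l) ^ 2 ≤
      2 * (∑ m, frac x m ^ 2 * y m ^ 2) + 2 * collision x * y l ^ 2 := by
    rw [collision, mul_sum, mul_sum, sum_mul, ← sum_add_distrib]
    refine sum_le_sum fun m _ => ?_
    nlinarith [mul_nonneg (sq_nonneg (frac x m)) (sq_nonneg (y m + y l))]
  refine (sum_le_sum fun v _ => h (x v)).trans ?_
  rw [sum_add_distrib, ← mul_sum, ← mul_sum, sum_nodes hn x fun l => y l ^ 2]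
  have h0 : 0 ≤ mean x fun l => y l ^ 2 :=
    sum_nonneg fun l _ => mul_nonneg (frac_nonneg x l) (sq_nonneg _)
  have h1 : ∑ m, frac x m ^ 2 * y m ^ 2 ≤ pmax x * mean x fun l => y l ^ 2 := by
    rw [mean, mul_sum]
    refine sum_le_sum fun m _ => ?_
    have := mul_le_mul_of_nonneg_right (frac_le_pmax x m)
      (mul_nonneg (frac_nonneg x m) (sq_nonneg (y m)))
    linarith
  have h2 := mul_le_mul_of_nonneg_right (collision_le_pmax hn x) h0
  have hn' : (0 : ℝ) ≤ n := by positivity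
  simp only [sum_const, card_univ, Fintype.card_fin, nsmul_eq_mul]
  nlinarith [mul_le_mul_of_nonneg_left h1 hn', mul_le_mul_of_nonneg_left h2 hn']

/-- Exponential moment of a linear statistic after one round. -/
theorem sum_exp_step_le (hn : 0 < n) (x : Config n k) (y : Fin k → ℝ) (r : ℝ)
    (hr : ∀ l m, |r * (y m - y l)| ≤ n) :
    ∑ s, Real.exp (r * mean (step x s) y) ≤ Fintype.card (Pulls n) *
      Real.exp (r * nextMean x y + r ^ 2 / n * (4 * pmax x * mean x fun l => y l ^ 2)) := by
  have hn' : (0 : ℝ) < n := by positivity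
  have h1 (s : Pulls n) : Real.exp (r * mean (step x s) y) =
      ∏ v, Real.exp (r / n * y (if x (s v).1 = x (s v).2 then x (s v).1 else x v)) := by
    rw [← Real.exp_sum, ← mul_sum]
    congr 1
    have := sum_nodes hn (step x s) y
    simp only [step] at this ⊢
    rw [this]
    field_simp
  have hz (l m : Fin k) : |r / n * (y m - y l)| ≤ 1 := by
    rw [div_mul_eq_mul_div, abs_div, abs_of_pos hn', div_le_one hn']
    exact hr l m
  simp only [h1]
  -- Independence of the nodes: the sum over all pulls of a product factorises.
  have h2 := Finset.prod_univ_sum (R := ℝ) (fun _ : Fin n => (univ : Finset (Fin n × Fin n)))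
    (fun v p => Real.exp (r / n * y (if x p.1 = x p.2 then x p.1 else x v)))
  rw [Fintype.piFinset_univ] at h2
  rw [← h2]
  refine (prod_le_prod (fun v _ => sum_nonneg fun _ _ => (Real.exp_pos _).le) fun v _ =>
    sum_exp_node_le hn x y (r / n) (x v) (hz (x v))).trans ?_
  rw [prod_mul_distrib, prod_const, card_univ, Fintype.card_fin, card_pulls, ← Real.exp_sum]
  refine mul_le_mul_of_nonneg_left (Real.exp_le_exp.2 ?_) (by positivity)
  have h3 := sum_nodes_drift hn x y
  have h4 := sum_nodes_variance_le hn x y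
  rw [sum_add_distrib] at h3
  rw [sum_add_distrib, sum_add_distrib, ← mul_sum, ← mul_sum, ← mul_sum, ← mul_add, h3]
  have h5 := mul_le_mul_of_nonneg_left h4 (sq_nonneg (r / n))
  have e1 : r / n * (n * nextMean x y) = r * nextMean x y := by field_simp
  have e2 : (r / n) ^ 2 * (4 * n * pmax x * mean x fun l => y l ^ 2) =
      r ^ 2 / n * (4 * pmax x * mean x fun l => y l ^ 2) := by field_simp
  rw [e1]
  rw [e2] at h5
  linarith

/-! ### From a potential to a count of bad trajectories -/

theorem traj_cons {T : ℕ} (x : Config n k) (s : Pulls n) (ω : Fin T → Pulls n) (t : ℕ) :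
    traj x (Fin.cons s ω : Fin (T + 1) → Pulls n) (t + 1) = traj (step x s) ω t := by
  induction t with
  | zero => simp [traj]
  | succ t ih =>
    rw [traj]
    by_cases h : t < T
    · rw [dif_pos (by omega), ih, traj, dif_pos h]
      rfl
    · rw [dif_neg (by omega), ih, traj, dif_neg h]

open Classical in
/-- A potential that is at least one, or does not increase in expectation, in every guarded
round bounds the number of guarded trajectories that end badly. -/
theorem card_bad_le (P G : Config n k → Prop) (Ψ : ℕ → Config n k → ℝ) (T : ℕ)
    (hnn : ∀ m x, 0 ≤ Ψ m x) (h0 : ∀ x, G x → 1 ≤ Ψ 0 x)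
    (hstep : ∀ m < T, ∀ x, P x → 1 ≤ Ψ (m + 1) x ∨
      ∑ s, Ψ m (step x s) ≤ Fintype.card (Pulls n) * Ψ (m + 1) x) :
    ∀ m ≤ T, ∀ x, (∑ ω : Fin m → Pulls n,
      if (∀ t < m, P (traj x ω t)) ∧ G (traj x ω m) then (1 : ℝ) else 0) ≤
        Fintype.card (Fin m → Pulls n) * Ψ m x := by
  intro m
  induction m with
  | zero =>
    intro _ x
    simp only [traj]
    by_cases hG : G x
    · simpa [hG] using h0 x hG
    · simpa [hG] using hnn 0 x
  | succ m ih =>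
    intro hm x
    by_cases hP : P x
    · rcases hstep m (by omega) x hP with h | h
      · calc _ ≤ ∑ ω : Fin (m + 1) → Pulls n, (1 : ℝ) :=
              sum_le_sum fun ω _ => by split_ifs <;> norm_num
          _ ≤ _ := by
              simp only [sum_const, card_univ, nsmul_eq_mul]
              exact mul_le_mul_of_nonneg_left h (by positivity)
      -- The first round is split off, so the potential is indexed by the rounds that remain.
      · rw [← (Fin.consEquiv fun _ => Pulls n).sum_comp, Fintype.sum_prod_type]
        calc _ ≤ ∑ s : Pulls n, (Fintype.card (Fin m → Pulls n) : ℝ) * Ψ m (step x s) := by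
              refine sum_le_sum fun s _ => le_trans (sum_le_sum fun ω _ => ?_)
                (ih (by omega) (step x s))
              change (if (∀ t < m + 1, P (traj x (Fin.cons s ω : Fin (m + 1) → Pulls n) t)) ∧
                G (traj x (Fin.cons s ω : Fin (m + 1) → Pulls n) (m + 1)) then (1 : ℝ) else 0) ≤ _
              rw [traj_cons]
              split_ifs with h1 h2
              · rfl
              · refine absurd ⟨fun t ht => ?_, h1.2⟩ h2
                have := h1.1 (t + 1) (by omega)
                rwa [traj_cons] at this
              · norm_num
              · rfl
          _ ≤ _ := by
              rw [← mul_sum]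
              have hc : (Fintype.card (Fin (m + 1) → Pulls n) : ℝ) =
                  Fintype.card (Fin m → Pulls n) * Fintype.card (Pulls n) := by
                simp only [Fintype.card_fun, Fintype.card_fin]
                push_cast
                ring
              rw [hc, mul_assoc]
              exact mul_le_mul_of_nonneg_left h (by positivity)
    · rw [sum_eq_zero]
      · exact mul_nonneg (by positivity) (hnn _ _)
      · intro ω _
        rw [if_neg]
        exact fun h => hP (h.1 0 (by omega))

theorem pullLaw_real_ge (hn : 0 < n) {T : ℕ} (A : (Fin T → Pulls n) → Prop) [DecidablePred A]
    (ε : ℝ) (h : (∑ ω, if A ω then (1 : ℝ) else 0) ≤ Fintype.card (Fin T → Pulls n) * ε) :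
    1 - ε ≤ (pullLaw n T).real {ω | ¬ A ω} := by
  have : NeZero n := ⟨hn.ne'⟩
  have : MeasureTheory.IsProbabilityMeasure (pullLaw n T) :=
    ProbabilityTheory.isProbabilityMeasure_uniformOn Set.finite_univ Set.univ_nonempty
  have hA : (pullLaw n T).real {ω | A ω} ≤ ε := by
    have hc : (0 : ℝ) < Fintype.card (Fin T → Pulls n) := by
      exact_mod_cast Fintype.card_pos
    rw [MeasureTheory.measureReal_def, pullLaw, ProbabilityTheory.uniformOn_univ,
      ENNReal.toReal_div, MeasureTheory.Measure.count_apply_finite _ (Set.toFinite _)]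
    simp only [ENNReal.toReal_natCast]
    rw [div_le_iff₀ hc, mul_comm]
    refine le_trans (le_of_eq ?_) h
    rw [sum_boole]
    congr 2
    ext ω
    simp
  have h1 := MeasureTheory.probReal_compl_eq_one_sub (μ := pullLaw n T)
    (MeasurableSet.of_discrete (s := {ω | A ω}))
  have h2 : {ω | ¬ A ω} = {ω | A ω}ᶜ := rfl
  rw [h2, h1]
  linarith

/-! ### The two statistics of the phase -/

/-- The step bound for the statistic `p_i - w p_j`. -/
theorem sum_exp_pair_le (hn : 0 < n) {κ : ℕ} (hκ : 0 < κ) (x : Config n k) {i j : Fin k}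
    (hij : i ≠ j) (hp : pmax x ≤ 1.5 / (κ : ℝ)) {w r : ℝ} (hw : 0 ≤ w) (hw' : w ≤ 6)
    (hr : 0 ≤ r) (hr' : 7 * r ≤ n) :
    ∑ s, Real.exp (-(r * (frac (step x s) i - w * frac (step x s) j))) ≤
      Fintype.card (Pulls n) * Real.exp (-(r * ((1 - collision x) * (frac x i - w * frac x j) +
        (frac x i ^ 2 - w * frac x j ^ 2))) + r ^ 2 / n * (333 / (κ : ℝ) ^ 2)) := by
  have hκ' : (0 : ℝ) < κ := by positivity
  let y : Fin k → ℝ := fun l => (if l = i then 1 else 0) - w * (if l = j then 1 else 0)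
  have hmean (z : Config n k) : mean z y = frac z i - w * frac z j := by
    simp [mean, y, mul_sub, sum_sub_distrib]
    ring
  have hy2 (l : Fin k) : y l ^ 2 = (if l = i then 1 else 0) + w ^ 2 * (if l = j then 1 else 0) := by
    simp only [y]
    split_ifs with h1 h2
    · exact absurd (h1.symm.trans h2) hij
    all_goals ring
  have hnext : nextMean x y = (1 - collision x) * (frac x i - w * frac x j) +
      (frac x i ^ 2 - w * frac x j ^ 2) := by
    rw [nextMean, hmean]
    simp [y, mul_sub, sum_sub_distrib]
    ring
  have hsq : (mean x fun l => y l ^ 2) = frac x i + w ^ 2 * frac x j := by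
    simp only [hy2]
    simp [mean, mul_add, sum_add_distrib]
    ring
  have hdiff (l m : Fin k) : |-r * (y m - y l)| ≤ n := by
    have h1 : |y m - y l| ≤ 7 := by
      rw [abs_le]
      simp only [y]
      split_ifs <;> constructor <;> linarith
    rw [abs_mul, abs_neg, abs_of_nonneg hr]
    nlinarith
  have h := sum_exp_step_le hn x y (-r) hdiff
  simp only [hmean, hnext, hsq] at h
  simp only [← neg_mul]
  refine h.trans (mul_le_mul_of_nonneg_left (Real.exp_le_exp.2 ?_) (by positivity))
  rw [neg_sq]
  refine add_le_add le_rfl (mul_le_mul_of_nonneg_left ?_ (by positivity))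
  have hi := (frac_le_pmax x i).trans hp
  have hj := (frac_le_pmax x j).trans hp
  have h3 : frac x i + w ^ 2 * frac x j ≤ 37 * (1.5 / (κ : ℝ)) := by
    have hw2 : w ^ 2 ≤ 36 := by nlinarith
    have := mul_le_mul hw2 hj (frac_nonneg x j) (by norm_num)
    linarith
  have h4 : 0 ≤ frac x i + w ^ 2 * frac x j :=
    add_nonneg (frac_nonneg x i) (mul_nonneg (sq_nonneg w) (frac_nonneg x j))
  -- Here 37 = 1 + 6² comes from w ≤ 6, and 333 = 4 · 1.5 · 37 · 1.5.
  calc 4 * pmax x * (frac x i + w ^ 2 * frac x j)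
      ≤ 4 * (1.5 / (κ : ℝ)) * (37 * (1.5 / (κ : ℝ))) :=
        mul_le_mul (by linarith) h3 h4 (by positivity)
    _ = 333 / (κ : ℝ) ^ 2 := by field_simp; norm_num

/-- The step bound for the statistic `p_j`. -/
theorem sum_exp_frac_le (hn : 0 < n) {κ : ℕ} (hκ : 0 < κ) (x : Config n k) (j : Fin k)
    (hp : pmax x ≤ 1.5 / (κ : ℝ)) {r : ℝ} (hr : 0 ≤ r) (hr' : r ≤ n) :
    ∑ s, Real.exp (-(r * frac (step x s) j)) ≤
      Fintype.card (Pulls n) * Real.exp (-(r * (frac x j * (1 + frac x j - collision x))) +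
        r ^ 2 / n * (333 / (κ : ℝ) ^ 2)) := by
  have hκ' : (0 : ℝ) < κ := by positivity
  let y : Fin k → ℝ := fun l => if l = j then 1 else 0
  have hmean (z : Config n k) : mean z y = frac z j := by simp [mean, y]
  have hnext : nextMean x y = frac x j * (1 + frac x j - collision x) := by
    rw [nextMean, hmean]
    simp [y]
    ring
  have hsq : (mean x fun l => y l ^ 2) = frac x j := by simp [mean, y]
  have hdiff (l m : Fin k) : |-r * (y m - y l)| ≤ n := by
    have h1 : |y m - y l| ≤ 1 := by
      rw [abs_le]
      simp only [y]
      split_ifs <;> constructor <;> linarith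
    rw [abs_mul, abs_neg, abs_of_nonneg hr]
    nlinarith
  have h := sum_exp_step_le hn x y (-r) hdiff
  simp only [hmean, hnext, hsq] at h
  simp only [← neg_mul]
  refine h.trans (mul_le_mul_of_nonneg_left (Real.exp_le_exp.2 ?_) (by positivity))
  rw [neg_sq]
  refine add_le_add le_rfl (mul_le_mul_of_nonneg_left ?_ (by positivity))
  have hj := (frac_le_pmax x j).trans hp
  -- A constant 9 would do; 333 lets both exponentials share one variance factor.
  calc 4 * pmax x * frac x j ≤ 4 * (1.5 / (κ : ℝ)) * (1.5 / (κ : ℝ)) :=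
        mul_le_mul (by linarith) hj (frac_nonneg x j) (by positivity)
    _ ≤ 333 / (κ : ℝ) ^ 2 := by
        rw [show 4 * (1.5 / (κ : ℝ)) * (1.5 / (κ : ℝ)) = 9 / (κ : ℝ) ^ 2 by field_simp; norm_num]
        gcongr
        norm_num

/-! ### Drift and the potential -/

/-- With D = a - (1+θ)b, one has a² - (1+θ)b² = D(a + (1+θ)b) + θ(1+θ)b². The last term pays for
raising θ by e. -/
theorem drift_ge {a b S θ e q : ℝ} (ha : 0 ≤ a) (hb : 0 ≤ b) (hθ : 0 ≤ θ) (hS : S ≤ 1 - q)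
    (hD : 0 ≤ a - (1 + (θ : ℝ)) * b) (he : e * (1 + b - S) ≤ θ * (1 + θ) * b) :
    q * (a - (1 + θ) * b) ≤
      (1 - S) * (a - (1 + (θ + e)) * b) + (a ^ 2 - (1 + (θ + e)) * b ^ 2) := by
  have h1 := mul_le_mul_of_nonneg_right he hb
  have h2 : 0 ≤ (a - (1 + θ) * b) * (1 - S - q + a + (1 + θ) * b) :=
    mul_nonneg hD (by have : 0 ≤ (1 + θ) * b := by positivity
                      linarith)
  linarith

/-- The gap to be exceeded when `m` rounds remain. -/
noncomputable def target (δ g : ℝ) (κ m : ℕ) : ℝ := g * (1 + δ / 100) - 0.04 * g * m / κ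

/-- The least factor by which the expected support of an opinion shrinks in one round. -/
noncomputable def decay (κ : ℕ) : ℝ := 1 - 1.5 / κ

/-- The bound for the probability of failure when `m` of `T` rounds remain. -/
noncomputable def potential (κ T : ℕ) (δ g Λ : ℝ) (i j : Fin k) (m : ℕ) (x : Config n k) : ℝ :=
  Real.exp (m * (Λ ^ 2 / n * (333 / (κ : ℝ) ^ 2))) *
    (Real.exp (-(Λ * decay κ ^ m * (frac x i - (1 + target δ g κ m) * frac x j))) +
      Real.exp (-(Λ * decay κ ^ m * frac x j) + Λ * (decay κ ^ T * (0.1 / κ))))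

theorem decay_ge {κ : ℕ} (hκ : 2 ≤ κ) : 1 / 4 ≤ decay κ := by
  have h : (2 : ℝ) ≤ κ := by exact_mod_cast hκ
  have : 1.5 / (κ : ℝ) ≤ 3 / 4 := by
    rw [div_le_div_iff₀ (by positivity) (by norm_num)]; linarith
  unfold decay
  linarith

theorem decay_le_one (κ : ℕ) : decay κ ≤ 1 := by
  have : 0 ≤ 1.5 / (κ : ℝ) := by positivity
  unfold decay
  linarith

/-- Bernoulli's inequality: the loss is at most 1.5δ ≤ 0.015. -/
theorem decay_pow_ge {κ : ℕ} (hκ : 2 ≤ κ) {δ : ℝ} (hδ : δ ≤ 0.01) {d : ℕ} (hd : d ≤ δ * κ) :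
    0.985 ≤ decay κ ^ d := by
  have h : (0 : ℝ) < κ := by positivity
  have h1 := one_add_mul_le_pow (a := -(1.5 / (κ : ℝ)))
    (by have := decay_ge hκ; unfold decay at this; linarith) d
  rw [← sub_eq_add_neg 1 (1.5 / (κ : ℝ))] at h1
  have h2 : (d : ℝ) * (1.5 / κ) ≤ 1.5 * δ := by
    rw [mul_div_assoc', div_le_iff₀ h]
    linarith
  unfold decay
  linarith

theorem one_le_potential {κ T : ℕ} {δ g Λ : ℝ} {i j : Fin k} {m : ℕ} {x : Config n k}
    (hκ : 2 ≤ κ) (hΛ : 0 ≤ Λ)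
    (h : frac x i - (1 + target δ g κ m) * frac x j ≤ 0 ∨
      decay κ ^ m * frac x j ≤ decay κ ^ T * (0.1 / κ)) :
    1 ≤ potential κ T δ g Λ i j m x := by
  have hq : 0 ≤ decay κ := by linarith [decay_ge hκ]
  unfold potential
  refine one_le_mul_of_one_le_of_one_le (Real.one_le_exp (by positivity)) ?_
  rcases h with h | h
  · refine le_add_of_le_of_nonneg (Real.one_le_exp ?_) (Real.exp_pos _).le
    have := mul_nonneg (mul_nonneg hΛ (pow_nonneg hq m)) (neg_nonneg.2 h)
    linarith
  · refine le_add_of_nonneg_of_le (Real.exp_pos _).le (Real.one_le_exp ?_)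
    have := mul_le_mul_of_nonneg_left h hΛ
    linarith

theorem potential_step (hn : 0 < n) {κ T : ℕ} (hκ : 2 ≤ κ) {δ g Λ : ℝ} (hδ : 0 < δ)
    (hδ' : δ ≤ 0.01) (hT : (T : ℝ) ≤ δ * κ + 1) (hg : 0 < g) (hg' : g ≤ 4) (hΛ : 0 ≤ Λ)
    (hΛ' : 7 * Λ ≤ n) {i j : Fin k} (hij : i ≠ j) {m : ℕ} (hm : m < T) (x : Config n k)
    (hp : pmax x ≤ 1.5 / (κ : ℝ)) :
    1 ≤ potential κ T δ g Λ i j (m + 1) x ∨ ∑ s, potential κ T δ g Λ i j m (step x s) ≤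
      Fintype.card (Pulls n) * potential κ T δ g Λ i j (m + 1) x := by
  by_cases hA : frac x i - (1 + target δ g κ (m + 1)) * frac x j ≤ 0
  · exact Or.inl (one_le_potential hκ hΛ (Or.inl hA))
  by_cases hB : decay κ ^ (m + 1) * frac x j ≤ decay κ ^ T * (0.1 / κ)
  · exact Or.inl (one_le_potential hκ hΛ (Or.inr hB))
  right
  push Not at hA hB
  have hκ2 : (2 : ℝ) ≤ κ := by exact_mod_cast hκ
  have hκ0 : (0 : ℝ) < κ := by linarith
  have hq4 := decay_ge hκ
  have hq0 : 0 < decay κ := by linarith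
  have hq1 := decay_le_one κ
  obtain ⟨d, rfl⟩ : ∃ d, T = m + 1 + d := ⟨T - (m + 1), by omega⟩
  push_cast at hT
  have hm0 : (0 : ℝ) ≤ m := by positivity
  have hd0 : (0 : ℝ) ≤ d := by positivity
  have hd := decay_pow_ge hκ hδ' (d := d) (by linarith)
  -- Cancelling q^(m+1) leaves p_j > q^d · 0.1/κ, where d counts the rounds already played.
  have hb : 0.0985 / (κ : ℝ) ≤ frac x j := by
    rw [pow_add _ (m + 1) d, mul_assoc] at hB
    have h1 := lt_of_mul_lt_mul_left hB (pow_nonneg hq0.le _)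
    have h2 := mul_le_mul_of_nonneg_right hd (show (0 : ℝ) ≤ 0.1 / κ by positivity)
    have h3 : 0.985 * (0.1 / (κ : ℝ)) = 0.0985 / κ := by ring
    linarith
  have hS : collision x ≤ 1 - decay κ := by
    have := (collision_le_pmax hn x).trans hp
    unfold decay
    linarith
  have hm1 : ((m : ℝ) + 1) / κ ≤ 0.51 := by
    rw [div_le_iff₀ hκ0]
    nlinarith
  have hm2 : (0 : ℝ) ≤ m / κ := by positivity
  set θ := target δ g κ (m + 1) with hθdef
  set e : ℝ := 0.04 * g / κ with hedef
  have hθe : target δ g κ m = θ + e := by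
    rw [hθdef, hedef, target, target]
    push_cast
    ring
  have hθ : 0.9 * g ≤ θ := by
    rw [hθdef, target]
    push_cast
    have : 0.04 * g * ((m : ℝ) + 1) / κ = 0.04 * g * (((m : ℝ) + 1) / κ) := by ring
    rw [this]
    nlinarith [mul_pos hg hδ]
  have hθ0 : 0 ≤ θ := by linarith
  have he0 : 0 ≤ e := by positivity
  have hw : 1 + (θ + e) ≤ 6 := by
    rw [← hθe, target]
    have : 0.04 * g * (m : ℝ) / κ = 0.04 * g * ((m : ℝ) / κ) := by ring
    rw [this]
    nlinarith [mul_nonneg hg.le hm2]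
  have ha := frac_nonneg x i
  have hb0 := frac_nonneg x j
  have hb1 : frac x j ≤ 0.75 := by
    have h1 := (frac_le_pmax x j).trans hp
    unfold decay at hq4
    linarith
  have hS0 := collision_nonneg x
  -- This limits the slope 0.04 in `target`: 0.04 · 1.75 = 0.07 must stay below 0.9 · 0.0985.
  have he : e * (1 + frac x j - collision x) ≤ θ * (1 + θ) * frac x j := by
    have hh : 0 < g / κ := by positivity
    calc e * (1 + frac x j - collision x) ≤ e * 1.75 :=
          mul_le_mul_of_nonneg_left (by linarith) he0
      _ ≤ (0.9 * g) * (0.0985 / κ) := by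
          rw [hedef, show 0.04 * g / (κ : ℝ) * 1.75 = 0.07 * (g / κ) by ring,
            show 0.9 * g * (0.0985 / (κ : ℝ)) = 0.08865 * (g / κ) by ring]
          linarith
      _ ≤ θ * (1 + θ) * frac x j := by
          refine mul_le_mul ?_ hb (by positivity) (by positivity)
          nlinarith
  have hdrift := drift_ge ha hb0 hθ0 hS hA.le he
  have hpow0 : 0 ≤ decay κ ^ m := pow_nonneg hq0.le m
  have hpow1 : decay κ ^ m ≤ 1 := pow_le_one₀ hq0.le hq1
  set r := Λ * decay κ ^ m with hr
  have hr0 : 0 ≤ r := mul_nonneg hΛ hpow0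
  have hrΛ : r ≤ Λ := mul_le_of_le_one_right hΛ hpow1
  have hv : r ^ 2 / n * (333 / (κ : ℝ) ^ 2) ≤ Λ ^ 2 / n * (333 / (κ : ℝ) ^ 2) := by gcongr
  set v := Λ ^ 2 / n * (333 / (κ : ℝ) ^ 2) with hvdef
  have h1 := sum_exp_pair_le hn (by omega) x hij hp (w := 1 + (θ + e)) (by linarith) hw hr0
    (by linarith)
  have h2 := sum_exp_frac_le hn (by omega) x j hp hr0 (by linarith)
  have hcard : (0 : ℝ) ≤ Fintype.card (Pulls n) := by positivity
  -- The scale Λ q^m absorbs exactly the factor q lost in the drift of each statistic.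
  have hrm : Λ * decay κ ^ (m + 1) = r * decay κ := by rw [hr]; ring
  have h1' := h1.trans (mul_le_mul_of_nonneg_left (Real.exp_le_exp.2 (add_le_add
    (neg_le_neg (mul_le_mul_of_nonneg_left hdrift hr0)) hv)) hcard)
  have hdb : decay κ * frac x j ≤ frac x j * (1 + frac x j - collision x) := by
    rw [mul_comm]
    exact mul_le_mul_of_nonneg_left (by linarith) hb0
  have h2' := h2.trans (mul_le_mul_of_nonneg_left (Real.exp_le_exp.2 (add_le_add
    (neg_le_neg (mul_le_mul_of_nonneg_left hdb hr0)) hv)) hcard)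
  simp only [potential, hθe, ← hvdef, ← hr, ← hθdef, hrm]
  rw [← mul_sum, sum_add_distrib]
  simp only [Real.exp_add, ← sum_mul] at h1' h2' ⊢
  push_cast
  rw [add_mul (m : ℝ) 1 v, one_mul, Real.exp_add]
  set c := Real.exp (Λ * (decay κ ^ (m + 1 + d) * (0.1 / κ)))
  have hc : 0 ≤ c := (Real.exp_pos _).le
  calc _ ≤ Real.exp (m * v) * (Fintype.card (Pulls n) *
          (Real.exp (-(r * (decay κ * (frac x i - (1 + θ) * frac x j)))) * Real.exp v) +
        Fintype.card (Pulls n) *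
          (Real.exp (-(r * (decay κ * frac x j))) * Real.exp v) * c) := by
        refine mul_le_mul_of_nonneg_left (add_le_add h1' ?_) (Real.exp_pos _).le
        exact mul_le_mul_of_nonneg_right h2' hc
    _ = _ := by
        rw [← mul_assoc r, ← mul_assoc r]
        ring

/-! ### Initial configuration and size of n -/

/-- Opinions that are not super-weak hold at least nine tenths of the nodes. -/
theorem pmax_ge (hn : 0 < n) {κ : ℕ} (x : Config n k)
    (h : {l : Fin k | ¬ SuperWeak x l}.ncard ≤ κ) : 0.9 ≤ κ * pmax x := by
  classical
  have hk : 0 < k := (x ⟨0, hn⟩).pos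
  have hk' : (0 : ℝ) < k := by positivity
  have hp : 0 ≤ pmax x := (frac_nonneg x (x ⟨0, hn⟩)).trans (frac_le_pmax x _)
  have h1 := sum_frac hn x
  rw [← sum_filter_add_sum_filter_not univ (fun l => SuperWeak x l)] at h1
  have h2 : ∑ l with SuperWeak x l, frac x l ≤ 0.1 := by
    calc _ ≤ ∑ l with SuperWeak x l, 1 / (10 * (k : ℝ)) :=
          sum_le_sum fun l hl => (mem_filter.1 hl).2
      _ ≤ ∑ _l : Fin k, 1 / (10 * (k : ℝ)) :=
          sum_le_sum_of_subset_of_nonneg (filter_subset _ _) fun _ _ _ => by positivity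
      _ = 0.1 := by
          rw [sum_const, card_univ, Fintype.card_fin, nsmul_eq_mul]
          field_simp
          norm_num
  have h3 : ∑ l with ¬ SuperWeak x l, frac x l ≤ κ * pmax x := by
    calc _ ≤ ∑ l with ¬ SuperWeak x l, pmax x := sum_le_sum fun l _ => frac_le_pmax x l
      _ ≤ κ * pmax x := by
          rw [sum_const, nsmul_eq_mul]
          refine mul_le_mul_of_nonneg_right ?_ hp
          rw [Set.ncard_eq_toFinset_card'] at h
          simpa using h
  linarith

theorem one_le_mul_pmax (hn : 0 < n) (x : Config n k) : 1 ≤ k * pmax x := by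
  calc (1 : ℝ) = ∑ l, frac x l := (sum_frac hn x).symm
    _ ≤ ∑ _l : Fin k, pmax x := sum_le_sum fun l _ => frac_le_pmax x l
    _ = k * pmax x := by simp

theorem exists_forall_ge_log (A : ℝ) : ∃ n₀ : ℕ, 2 ≤ n₀ ∧ ∀ n : ℕ, n₀ ≤ n →
    A * Real.log n ≤ n := by
  have h := (Real.isLittleO_log_id_atTop.comp_tendsto tendsto_natCast_atTop_atTop).def
    (show (0 : ℝ) < 1 / (|A| + 1) by positivity)
  obtain ⟨N, hN⟩ := Filter.eventually_atTop.1 h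
  refine ⟨max N 2, le_max_right _ _, fun n hn => ?_⟩
  have h1 := hN n (le_of_max_le_left hn)
  simp only [Function.comp, id, Real.norm_eq_abs, Nat.abs_cast] at h1
  rw [div_mul_eq_mul_div, one_mul, le_div_iff₀ (by positivity)] at h1
  calc A * Real.log n ≤ |A * Real.log n| := le_abs_self _
    _ ≤ |Real.log n| * (|A| + 1) := by
        rw [abs_mul]
        nlinarith [abs_nonneg (Real.log n)]
    _ ≤ n := h1

/-- If κ = O(√(n / log n)), then κ log n = O(√(n log n)), which is below any fixed multiple of n for
large n. -/
theorem mul_log_le {n : ℕ} {κ K R : ℝ} (hR : 0 ≤ R) (hL : 0 < Real.log n)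
    (hκ : κ ≤ 1.5 * (K * √((n : ℝ) / Real.log n)))
    (h : (1.5 * R * K) ^ 2 * Real.log n ≤ n) : R * κ * Real.log n ≤ n := by
  have hs : √((n : ℝ) / Real.log n) * Real.log n = √n * √(Real.log n) := by
    rw [Real.sqrt_div (Nat.cast_nonneg n)]
    have : √(Real.log n) ≠ 0 := (Real.sqrt_pos.2 hL).ne'
    field_simp
    rw [Real.sq_sqrt hL.le]
  have h1 : 1.5 * R * K * √(Real.log n) ≤ √n := by
    refine Real.le_sqrt_of_sq_le ?_
    rw [mul_pow, Real.sq_sqrt hL.le]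
    exact h
  calc R * κ * Real.log n ≤ R * (1.5 * (K * √((n : ℝ) / Real.log n))) * Real.log n := by gcongr
    _ = 1.5 * R * K * (√((n : ℝ) / Real.log n) * Real.log n) := by ring
    _ = (1.5 * R * K * √(Real.log n)) * √n := by rw [hs]; ring
    _ ≤ √n * √n := by gcongr
    _ = n := Real.mul_self_sqrt (Nat.cast_nonneg n)

/-- With no round left, a potential below one forces p_j > 0, so the zero convention of `gap` does
not interfere. -/
theorem target_le_gap {κ T : ℕ} {δ g Λ : ℝ} {i j : Fin k} (hκ : 2 ≤ κ) (hΛ : 0 ≤ Λ)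
    (x : Config n k) (h : ¬ (1 + δ / 100) * g ≤ gap x i j) :
    1 ≤ potential κ T δ g Λ i j 0 x := by
  refine one_le_potential hκ hΛ ?_
  by_contra! hc
  have hq : 0 < decay κ := by linarith [decay_ge hκ]
  have hb : 0 < frac x j := by
    have : 0 ≤ decay κ ^ T * (0.1 / κ) := by positivity
    linarith [hc.2, pow_zero (decay κ)]
  refine h ?_
  rw [gap, le_div_iff₀ hb]
  have h1 := hc.1
  simp only [target, Nat.cast_zero, mul_zero, zero_div, sub_zero] at h1
  linarith

/-- The scale Λ = √(nκ log n) keeps the accumulated variance term below 333 log n, while the gap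
hypothesis makes Λg/κ at least 1000(c+334) log n / δ. -/
theorem potential_start_le (hn : 2 ≤ n) {κ T : ℕ} (hκ : 2 ≤ κ) {δ c g : ℝ} (hδ : 0 < δ)
    (hδ' : δ ≤ 0.01) (hc : 2 ≤ c) (hT : δ * κ ≤ T) (hT' : (T : ℝ) ≤ δ * κ + 1) (hg : 0 < g)
    {x : Config n k} {i j : Fin k} (hb : 0.18 / (κ : ℝ) ≤ frac x j)
    (ha : frac x i = (1 + g) * frac x j)
    (hgap : 1000 * (c + 334) / δ * √(Real.log n) / √((n : ℝ) / κ) ≤ g)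
    (hlarge : ((c + 334) / 0.016) ^ 2 * κ * Real.log n ≤ n) :
    potential κ T δ g √(n * κ * Real.log n) i j T x ≤ (n : ℝ) ^ (-c) := by
  have hn' : (2 : ℝ) ≤ n := by exact_mod_cast hn
  have hn0 : (0 : ℝ) < n := by linarith
  have hκ2 : (2 : ℝ) ≤ κ := by exact_mod_cast hκ
  have hκ0 : (0 : ℝ) < κ := by linarith
  set L := Real.log n with hL
  have hL0 : 0 < L := Real.log_pos (by linarith)
  set Λ := √(n * κ * L) with hΛ
  have hΛ0 : 0 ≤ Λ := Real.sqrt_nonneg _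
  have hΛ2 : Λ ^ 2 = n * κ * L := Real.sq_sqrt (by positivity)
  have hq4 := decay_ge hκ
  have hT1 : 1 ≤ T := by
    have : (0 : ℝ) < T := lt_of_lt_of_le (by positivity) hT
    exact_mod_cast this
  -- The ceiling may add one round, which costs a factor as small as 1/4 when κ = 2.
  have hqT : 1 / 5 ≤ decay κ ^ T := by
    obtain ⟨d, rfl⟩ := Nat.exists_eq_add_of_le' hT1
    push_cast at hT'
    have := decay_pow_ge hκ hδ' (d := d) (by linarith)
    rw [pow_succ]
    nlinarith
  have hv : T * (Λ ^ 2 / n * (333 / (κ : ℝ) ^ 2)) ≤ 333 * L := by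
    have h1 : T * (Λ ^ 2 / n * (333 / (κ : ℝ) ^ 2)) = 333 * L * (T / κ) := by
      rw [hΛ2]
      field_simp
    have h2 : (T : ℝ) / κ ≤ 1 := by
      rw [div_le_one hκ0]
      nlinarith
    rw [h1]
    nlinarith
  have hgΛ : 1000 * (c + 334) * L ≤ δ * (Λ * g / κ) := by
    have h1 : Λ * (√L / √((n : ℝ) / κ)) = κ * L := by
      rw [hΛ, Real.sqrt_mul (by positivity), Real.sqrt_div hn0.le, Real.sqrt_mul hn0.le]
      have : √(n : ℝ) ≠ 0 := (Real.sqrt_pos.2 hn0).ne'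
      field_simp
      rw [Real.sq_sqrt hκ0.le, Real.sq_sqrt hL0.le]
    have h2 := mul_le_mul_of_nonneg_left hgap hΛ0
    have h3 : Λ * (1000 * (c + 334) / δ * √L / √((n : ℝ) / κ)) =
        1000 * (c + 334) / δ * (κ * L) := by
      rw [← h1]
      ring
    rw [h3] at h2
    calc 1000 * (c + 334) * L = δ * (1000 * (c + 334) / δ * (κ * L) / κ) := by field_simp
      _ ≤ δ * (Λ * g / κ) := by gcongr
  have hfirst : (c + 334) * L ≤
      Λ * decay κ ^ T * (frac x i - (1 + target δ g κ T) * frac x j) := by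
    -- As T/κ ≥ δ, the initial threshold is at most g + 0.01δg - 0.04δg, which leaves slack below
    -- the true gap.
    have h1 : target δ g κ T ≤ g - 0.03 * δ * g := by
      have : δ ≤ T / κ := by rwa [le_div_iff₀ hκ0]
      have h2 : 0.04 * g * (T : ℝ) / κ = 0.04 * g * (T / κ) := by ring
      rw [target, h2]
      nlinarith
    have h2 : 0.03 * δ * g * (0.18 / κ) ≤ frac x i - (1 + target δ g κ T) * frac x j := by
      calc 0.03 * δ * g * (0.18 / κ) ≤ (g - target δ g κ T) * frac x j :=
            mul_le_mul (by linarith) hb (by positivity)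
              (le_trans (by positivity : 0 ≤ 0.03 * δ * g) (by linarith))
        _ = _ := by rw [ha]; ring
    calc (c + 334) * L ≤ 0.00108 * (1000 * (c + 334) * L) := by nlinarith
      _ ≤ 0.00108 * (δ * (Λ * g / κ)) := by gcongr
      _ = Λ * (1 / 5) * (0.03 * δ * g * (0.18 / κ)) := by ring
      _ ≤ _ := by gcongr
  have hsecond : (c + 334) * L ≤
      Λ * decay κ ^ T * frac x j - Λ * (decay κ ^ T * (0.1 / κ)) := by
    have h1 : (c + 334) / 0.016 * (κ * L) ≤ Λ := by
      refine Real.le_sqrt_of_sq_le ?_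
      calc ((c + 334) / 0.016 * (κ * L)) ^ 2
          = ((c + 334) / 0.016) ^ 2 * κ * L * (κ * L) := by ring
        _ ≤ n * (κ * L) := by gcongr
        _ = n * κ * L := by ring
    calc (c + 334) * L = (c + 334) / 0.016 * (κ * L) * (1 / 5) * (0.08 / κ) := by
          field_simp
          norm_num
      _ ≤ Λ * decay κ ^ T * (0.08 / κ) := by gcongr
      _ = Λ * decay κ ^ T * (0.18 / κ) - Λ * (decay κ ^ T * (0.1 / κ)) := by ring
      _ ≤ _ := by gcongr
  -- Here 334 = 333 + 1: variance costs 333 log n, and the spare 1/n absorbs the factor 2 from two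
  -- exponentials.
  calc potential κ T δ g Λ i j T x
      ≤ Real.exp (333 * L) * (Real.exp (-((c + 334) * L)) + Real.exp (-((c + 334) * L))) := by
        unfold potential
        gcongr
        linarith
    _ = 2 * Real.exp (-L) * Real.exp (-(c * L)) := by
        rw [← two_mul, mul_left_comm, ← Real.exp_add, mul_assoc, ← Real.exp_add]
        congr 2
        ring
    _ ≤ 1 * Real.exp (-(c * L)) := by
        gcongr
        rw [Real.exp_neg, hL, Real.exp_log hn0, ← div_eq_mul_inv, div_le_one hn0]
        exact hn'
    _ = (n : ℝ) ^ (-c) := by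
        rw [one_mul, Real.rpow_def_of_pos hn0]
        congr 1
        ring

end ThreeMajority

open ThreeMajority

theorem mainTheorem3 :
    ∃ δ₀ : ℝ, 0 < δ₀ ∧ ∀ δ : ℝ, 0 < δ → δ ≤ δ₀ →
    ∀ c : ℝ, 2 ≤ c →
    ∃ C₅ : ℝ, 0 < C₅ ∧
    ∀ K : ℝ, 0 < K → ∃ n₀ : ℕ, 2 ≤ n₀ ∧
    ∀ n k κ : ℕ, n₀ ≤ n → (k : ℝ) ≤ K * √((n : ℝ) / Real.log n) → 2 ≤ κ →
    ∀ (x : ThreeMajority.Config n k) (i j : Fin k),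
      {l : Fin k | ¬ ThreeMajority.SuperWeak x l}.ncard ≤ κ →
      ThreeMajority.pmax x ≤ 1.5 / (κ : ℝ) →
      ThreeMajority.Strong x i → ThreeMajority.Strong x j →
      ThreeMajority.frac x j ≤ ThreeMajority.frac x i →
      C₅ * √(Real.log n) / √((n : ℝ) / (κ : ℝ)) ≤ ThreeMajority.gap x i j →
      1 - (n : ℝ) ^ (-c) ≤
        (ThreeMajority.pullLaw n ⌈δ * (κ : ℝ)⌉₊).real
          {ω | (∀ t < ⌈δ * (κ : ℝ)⌉₊,
                  ThreeMajority.pmax (ThreeMajority.traj x ω t) ≤ 1.5 / (κ : ℝ)) →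
                (1 + δ / 100) * ThreeMajority.gap x i j ≤
                  ThreeMajority.gap (ThreeMajority.traj x ω ⌈δ * (κ : ℝ)⌉₊) i j} := by
  classical
  refine ⟨0.01, by norm_num, fun δ hδ hδ' c hc => ⟨1000 * (c + 334) / δ, by positivity,
    fun K _ => ?_⟩⟩
  -- The entry 49 yields 7Λ ≤ n, needed for the exponential moments; the other keeps the exponential
  -- for p_j small at the start.
  set R : ℝ := max 49 (((c + 334) / 0.016) ^ 2) with hR
  have hR49 : 49 ≤ R := le_max_left _ _
  obtain ⟨n₀, hn₀, hlog⟩ := exists_forall_ge_log ((1.5 * R * K) ^ 2)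
  refine ⟨n₀, hn₀, fun n k κ hn hk hκ x i j hweak hp _ hj _ hgap => ?_⟩
  have hn2 : 2 ≤ n := hn₀.trans hn
  have hn0 : 0 < n := by omega
  have hn' : (2 : ℝ) ≤ n := by exact_mod_cast hn2
  have hκ2 : (2 : ℝ) ≤ κ := by exact_mod_cast hκ
  have hκ0 : (0 : ℝ) < κ := by linarith
  have hL : 0 < Real.log n := Real.log_pos (by linarith)
  have hκk : (κ : ℝ) ≤ 1.5 * k := by
    have h1 := (one_le_mul_pmax hn0 x).trans (mul_le_mul_of_nonneg_left hp (Nat.cast_nonneg k))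
    rw [mul_div_assoc', le_div_iff₀ hκ0] at h1
    linarith
  have hlarge : R * κ * Real.log n ≤ n :=
    mul_log_le (by linarith) hL (hκk.trans (by linarith)) (hlog n hn)
  have hκL : 0 ≤ (κ : ℝ) * Real.log n := by positivity
  -- Here 0.18 = 0.9/5, from p_max ≥ 0.9/κ and the strength of j.
  have hb : 0.18 / (κ : ℝ) ≤ frac x j := by
    have h1 := pmax_ge hn0 x hweak
    unfold Strong at hj
    rw [div_le_iff₀ hκ0]
    nlinarith
  have hb0 : 0 < frac x j := lt_of_lt_of_le (by positivity) hb
  have hg : 0 < gap x i j := lt_of_lt_of_le (by positivity) hgap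
  have ha : frac x i = (1 + gap x i j) * frac x j := by
    unfold gap
    field_simp
    ring
  have hg4 : gap x i j ≤ 4 := by
    have h1 := frac_le_pmax x i
    unfold Strong at hj
    rw [gap, div_le_iff₀ hb0]
    linarith
  have hij : i ≠ j := by
    rintro rfl
    simp [gap] at hg
  set T := ⌈δ * (κ : ℝ)⌉₊
  have hT : δ * κ ≤ T := Nat.le_ceil _
  have hT' : (T : ℝ) ≤ δ * κ + 1 := (Nat.ceil_lt_add_one (by positivity)).le
  set Λ := √(n * κ * Real.log n) with hΛ
  have hΛ0 : 0 ≤ Λ := Real.sqrt_nonneg _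
  have hΛn : 7 * Λ ≤ n := by
    have h1 : Λ ≤ n / 7 := by
      refine Real.sqrt_le_iff.2 ⟨by positivity, ?_⟩
      have : 49 * (κ * Real.log n) ≤ n :=
        (mul_le_mul_of_nonneg_right hR49 hκL).trans (by linarith)
      nlinarith
    linarith
  have hstart := potential_start_le hn2 hκ hδ hδ' hc hT hT' hg hb ha hgap
    (le_trans (by gcongr; exact le_max_right _ _) hlarge)
  have hcount := card_bad_le (fun z : Config n k => pmax z ≤ 1.5 / (κ : ℝ))
    (fun z => ¬ (1 + δ / 100) * gap x i j ≤ gap z i j)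
    (potential κ T δ (gap x i j) Λ i j) T (fun m z => by unfold potential; positivity)
    (target_le_gap hκ hΛ0)
    (fun m hm z hz => potential_step hn0 hκ hδ hδ' hT' hg hg4 hΛ0 hΛn hij hm z hz) T le_rfl x
  have h := pullLaw_real_ge hn0 (fun ω : Fin T → Pulls n =>
    (∀ t < T, pmax (traj x ω t) ≤ 1.5 / (κ : ℝ)) ∧
      ¬ (1 + δ / 100) * gap x i j ≤ gap (traj x ω T) i j) ((n : ℝ) ^ (-c))
    (by
      refine le_trans (le_of_eq ?_) (hcount.trans (mul_le_mul_of_nonneg_left hstart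
        (by positivity)))
      exact Finset.sum_congr rfl fun ω _ => by congr)
  simpa only [not_and, not_not] using h
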